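/- Theorem. Let $p$ be a prime, let $F$ be a finite extension of $\mathbb{Q}_p$ with its $p$-adic topology and normalised discrete valuation $v_F : F^\times \to \mathbb{Z}$, and let $k$ be a field of characteristic $p$. Let $U_3 \le GL_3(F)$ be the group of all upper unitriangular matrices, let $u, v \in F^\times$ with $v_F(u) > 0$ and $v_F(v) < 0$, put $t = \mathrm{diag}(u, 1, v^{-1}) \in GL_3(F)$, and let $H_{3,t} = \langle t, U_3 \rangle \le GL_3(F)$ with the subspace topology. For a locally profinite group $G$ (such as a $p$-adic Lie group) let $kG = k[G] \otimes_{k[H]} kH$ be its augmented Iwasawa algebra, where $H \le G$ is any compact open subgroup and $kH = \varprojlim_N k[H/N]$ ($N$ running over the open normal subgroups of $H$) is its completed group algebra; equivalently, $kG$ is the convolution algebra of compactly supported $k$-valued distributions on $G$ (linear functionals on the locally constant functions $G \to k$ that only depend on the restriction to some compact set). Then $kH_{3,t}$ is neither left coherent nor right coherent, that is, it has a finitely generated left ideal that is not finitely presented, and a finitely generated right ideal that is not finitely presented. -/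

import Mathlib

open Topology

/-! ### Coherent rings -/

/-- A ring is left coherent if every finitely generated left ideal is finitely presented. -/
def IsLeftCoherent (R : Type*) [Ring R] : Prop :=
  ∀ I : Submodule R R, I.FG → Module.FinitePresentation R I

/-- A ring is right coherent if every finitely generated right ideal is finitely presented. -/
def IsRightCoherent (R : Type*) [Ring R] : Prop :=
  ∀ I : Submodule Rᵐᵒᵖ R, I.FG → Module.FinitePresentation Rᵐᵒᵖ I

/-! ### The augmented Iwasawa algebra -/

section AugmentedIwasawa

set_option linter.unusedSectionVars false

variable (k G : Type*) [Field k] [Group G] [TopologicalSpace G] [IsTopologicalGroup G]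

/-- The linear functional `μ` on locally constant functions is supported on `K`. -/
def DistSupportedOn {k G : Type*} [Field k] [TopologicalSpace G]
    (μ : LocallyConstant G k →ₗ[k] k) (K : Set G) : Prop :=
  ∀ f : LocallyConstant G k, (∀ x ∈ K, f x = 0) → μ f = 0

/-- The space of compactly supported `k`-valued distributions on `G`, that is, of `k`-linear
functionals on the locally constant functions `G → k` (`k` is discrete) with compact support. -/
def compactDistributions : Submodule k (LocallyConstant G k →ₗ[k] k) where
  carrier := {μ | ∃ K : Set G, IsCompact K ∧ DistSupportedOn μ K}
  zero_mem' := ⟨∅, isCompact_empty, fun _ _ => rfl⟩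
  add_mem' := by
    rintro μ ν ⟨K, hK, hμ⟩ ⟨L, hL, hν⟩
    refine ⟨K ∪ L, hK.union hL, fun f hf => ?_⟩
    rw [LinearMap.add_apply, hμ f fun x hx => hf x (Or.inl hx),
      hν f fun x hx => hf x (Or.inr hx), add_zero]
  smul_mem' := by
    rintro c μ ⟨K, hK, hμ⟩
    refine ⟨K, hK, fun f hf => ?_⟩
    rw [LinearMap.smul_apply, hμ f hf, smul_zero]

/-- The augmented Iwasawa algebra `kG` of a locally profinite group `G` (for instance a `p`-adic
Lie group), realised as the convolution algebra of compactly supported distributions on `G`.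

If `H` is a profinite group, the locally constant functions on `H` are the directed union over the
open normal subgroups `N` of the spaces of functions on `H/N`, so that their `k`-linear dual is
`lim_N k[H/N]`, the completed group algebra `kH`. If `H` is an open compact subgroup of `G`, a
compact subset of `G` meets only finitely many cosets `gH`, and so compactly supported
distributions on `G` form the direct sum of the translates `g • kH` over `gH ∈ G/H`. This is
`k[G] ⊗_{k[H]} kH`, with the product that extends those of `k[G]` and `kH`. -/
def AugIwasawa : Type _ := compactDistributions k G

namespace AugIwasawa

noncomputable instance : AddCommGroup (AugIwasawa k G) :=
  inferInstanceAs (AddCommGroup (compactDistributions k G))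

noncomputable instance : Module k (AugIwasawa k G) :=
  inferInstanceAs (Module k (compactDistributions k G))

variable {k G}

/-- Integrating a locally constant function against a distribution. -/
def integ (μ : AugIwasawa k G) : LocallyConstant G k →ₗ[k] k := μ.1

theorem exists_support (μ : AugIwasawa k G) :
    ∃ K : Set G, IsCompact K ∧ DistSupportedOn μ.integ K := μ.2

@[ext]
theorem ext {μ ν : AugIwasawa k G} (h : ∀ f, μ.integ f = ν.integ f) : μ = ν :=
  Subtype.ext (LinearMap.ext h)

@[simp] theorem integ_add (μ ν : AugIwasawa k G) (f : LocallyConstant G k) :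
    (μ + ν).integ f = μ.integ f + ν.integ f := rfl

@[simp] theorem integ_zero (f : LocallyConstant G k) : (0 : AugIwasawa k G).integ f = 0 := rfl

/-- The left translate `y ↦ f (x * y)`. -/
def translate (x : G) (f : LocallyConstant G k) : LocallyConstant G k :=
  f.comap ⟨fun y => x * y, continuous_const_mul x⟩

@[simp] theorem translate_apply (x y : G) (f : LocallyConstant G k) :
    translate x f y = f (x * y) := rfl

theorem integ_congr (μ : AugIwasawa k G) {K : Set G} (hK : DistSupportedOn μ.integ K)
    {f g : LocallyConstant G k} (h : ∀ x ∈ K, f x = g x) : μ.integ f = μ.integ g := by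
  have := hK (f - g) fun x hx => by
    rw [LocallyConstant.sub_apply, h x hx, sub_self]
  rwa [map_sub, sub_eq_zero] at this

theorem isLocallyConstant_integ_translate (ν : AugIwasawa k G) (f : LocallyConstant G k) :
    IsLocallyConstant fun x => ν.integ (translate x f) := by
  obtain ⟨K, hK, hν⟩ := ν.exists_support
  rw [IsLocallyConstant.iff_eventually_eq]
  intro x
  have key : ∀ᶠ x' in 𝓝 x, ∀ y ∈ K, f (x' * y) = f (x * y) := by
    refine hK.eventually_forall_of_forall_eventually fun y _ => ?_
    have h1 : ∀ᶠ z : G × G in 𝓝 (x, y), f (z.1 * z.2) = f (x * y) :=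
      (continuous_mul.tendsto (x, y)).eventually (f.isLocallyConstant.eventually_eq (x * y))
    have h2 : ∀ᶠ z : G × G in 𝓝 (x, y), f (x * z.2) = f (x * y) :=
      ((continuous_const.mul continuous_snd).tendsto (x, y)).eventually
        (f.isLocallyConstant.eventually_eq (x * y))
    filter_upwards [h1, h2] with z hz1 hz2
    rw [hz1, hz2]
  filter_upwards [key] with x' hx'
  exact ν.integ_congr hν hx'

/-- The locally constant function `x ↦ ∫ f (x * y) dν(y)`. -/
def inner (ν : AugIwasawa k G) (f : LocallyConstant G k) : LocallyConstant G k :=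
  ⟨fun x => ν.integ (translate x f), ν.isLocallyConstant_integ_translate f⟩

@[simp] theorem inner_apply (ν : AugIwasawa k G) (f : LocallyConstant G k) (x : G) :
    ν.inner f x = ν.integ (translate x f) := rfl

/-- The functional `f ↦ ∫ ∫ f (x * y) dν(y) dμ(x)`. -/
def convFun (μ ν : AugIwasawa k G) : LocallyConstant G k →ₗ[k] k where
  toFun f := μ.integ (ν.inner f)
  map_add' f g := by
    rw [← map_add]
    congr 1
    ext x
    exact map_add ν.integ (translate x f) (translate x g)
  map_smul' c f := by
    rw [RingHom.id_apply, ← map_smul]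
    congr 1
    ext x
    exact map_smul ν.integ c (translate x f)

theorem convFun_mem (μ ν : AugIwasawa k G) : convFun μ ν ∈ compactDistributions k G := by
  obtain ⟨K, hK, hμ⟩ := μ.exists_support
  obtain ⟨L, hL, hν⟩ := ν.exists_support
  refine ⟨(fun z : G × G => z.1 * z.2) '' (K ×ˢ L), (hK.prod hL).image continuous_mul,
    fun f hf => hμ _ fun x hx => hν _ fun y hy => hf _ ⟨(x, y), ⟨hx, hy⟩, rfl⟩⟩

/-- The point mass at `g`; these are the group elements inside `kG`. -/
def dirac (g : G) : AugIwasawa k G :=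
  ⟨LocallyConstant.evalₗ k g, {g}, isCompact_singleton, fun _ hf => hf g rfl⟩

@[simp] theorem integ_dirac (g : G) (f : LocallyConstant G k) :
    (dirac g : AugIwasawa k G).integ f = f g := rfl

/-- Multiplication is convolution. -/
noncomputable instance : Mul (AugIwasawa k G) := ⟨fun μ ν => ⟨convFun μ ν, convFun_mem μ ν⟩⟩

noncomputable instance : One (AugIwasawa k G) := ⟨dirac 1⟩

theorem integ_mul (μ ν : AugIwasawa k G) (f : LocallyConstant G k) :
    (μ * ν).integ f = μ.integ (ν.inner f) := rfl

theorem integ_one (f : LocallyConstant G k) : (1 : AugIwasawa k G).integ f = f 1 := rfl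

noncomputable instance : Ring (AugIwasawa k G) where
  __ := (inferInstance : AddCommGroup (AugIwasawa k G))
  mul := (· * ·)
  one := 1
  left_distrib μ ν ρ := by
    ext f
    rw [integ_add, integ_mul, integ_mul, integ_mul, ← map_add]
    rfl
  right_distrib μ ν ρ := rfl
  zero_mul μ := rfl
  mul_zero μ := by
    ext f
    rw [integ_mul]
    exact map_zero μ.integ
  mul_assoc μ ν ρ := by
    ext f
    simp only [integ_mul]
    congr 1
    ext x
    simp only [inner_apply, integ_mul]
    congr 1
    ext y
    simp only [inner_apply, translate_apply]
    congr 1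
    ext z
    simp [mul_assoc]
  one_mul μ := by
    ext f
    rw [integ_mul, integ_one, inner_apply]
    congr 1
    ext y
    simp
  mul_one μ := by
    ext f
    rw [integ_mul]
    congr 1
    ext x
    rw [inner_apply, integ_one, translate_apply, mul_one]

theorem dirac_mul_dirac (g h : G) :
    (dirac g * dirac h : AugIwasawa k G) = dirac (g * h) := rfl

end AugIwasawa

end AugmentedIwasawa

/-! ### The normalised valuation of a finite extension of `ℚ_p` -/

section Valuation

/-- `ϖ` generates the maximal ideal `{x | ‖x‖ < 1}` of the ring of integers `{x | ‖x‖ ≤ 1}`. -/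
def IsUniformizer {F : Type*} [NormedField F] (ϖ : F) : Prop :=
  ϖ ≠ 0 ∧ ‖ϖ‖ < 1 ∧ ∀ x : F, ‖x‖ < 1 → ‖x‖ ≤ ‖ϖ‖

theorem exists_isUniformizer (p : ℕ) [Fact p.Prime] (F : Type*) [NormedField F]
    [NormedAlgebra ℚ_[p] F] [FiniteDimensional ℚ_[p] F] : ∃ ϖ : F, IsUniformizer ϖ := by
  have hp : ProperSpace F := FiniteDimensional.proper ℚ_[p] F
  have hu : IsUltrametricDist F :=
    IsUltrametricDist.isUltrametricDist_of_forall_norm_natCast_le_one fun n => by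
      rw [← map_natCast (algebraMap ℚ_[p] F) n, norm_algebraMap']
      exact Padic.norm_int_le_one (n : ℤ)
  have hc : IsCompact (Metric.ball (0 : F) 1) :=
    (isCompact_closedBall (0 : F) 1).of_isClosed_subset (IsUltrametricDist.isClosed_ball 0 1)
      Metric.ball_subset_closedBall
  obtain ⟨ϖ, hϖ, hmax⟩ := hc.exists_isMaxOn ⟨0, by simp⟩ continuous_norm.continuousOn
  have hpF : ‖(p : F)‖ = (p : ℝ)⁻¹ := by
    rw [← map_natCast (algebraMap ℚ_[p] F) p, norm_algebraMap', Padic.norm_p]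
  have hp1 : (1 : ℝ) < p := by exact_mod_cast (Fact.out : p.Prime).one_lt
  have h1 : ‖(p : F)‖ ≤ ‖ϖ‖ := hmax (by simpa [hpF] using inv_lt_one_of_one_lt₀ hp1)
  refine ⟨ϖ, ?_, by simpa using hϖ, fun x hx => hmax (by simpa using hx)⟩
  rw [← norm_pos_iff]
  refine lt_of_lt_of_le ?_ h1
  rw [hpF]
  positivity

theorem IsUniformizer.existsUnique_zpow {F : Type*} [NormedField F] {ϖ : F}
    (h : IsUniformizer ϖ) (x : Fˣ) : ∃! m : ℤ, ‖(x : F)‖ = ‖ϖ‖ ^ m := by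
  obtain ⟨h0, h1, hmax⟩ := h
  have hpos : 0 < ‖ϖ‖ := norm_pos_iff.mpr h0
  have hx : 0 < ‖(x : F)‖ := norm_pos_iff.mpr x.ne_zero
  obtain ⟨n, hn1, hn2⟩ := exists_mem_Ico_zpow hx ((one_lt_inv₀ hpos).mpr h1)
  have hn : ‖(x : F)‖ = ‖ϖ‖ ^ (-n) := by
    by_contra hne
    rw [inv_zpow', zpow_neg] at hn1
    rw [zpow_neg] at hne
    have hlt : (‖ϖ‖ ^ n)⁻¹ < ‖(x : F)‖ := lt_of_le_of_ne hn1 (Ne.symm hne)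
    have hz : 0 < ‖ϖ‖ ^ n := zpow_pos hpos n
    have hy : ‖(ϖ ^ n * x : F)⁻¹‖ < 1 := by
      rw [norm_inv, norm_mul, norm_zpow]
      apply inv_lt_one_of_one_lt₀
      rwa [inv_lt_iff_one_lt_mul₀ hz, mul_comm] at hlt
    have := hmax _ hy
    rw [norm_inv, norm_mul, norm_zpow, inv_le_comm₀ (by positivity) hpos] at this
    rw [inv_zpow', neg_add, zpow_add₀ hpos.ne', zpow_neg, zpow_neg, zpow_one] at hn2
    have h3 : ‖ϖ‖ ^ n * ‖(x : F)‖ < ‖ϖ‖⁻¹ := by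
      calc _ < ‖ϖ‖ ^ n * ((‖ϖ‖ ^ n)⁻¹ * ‖ϖ‖⁻¹) := by gcongr
        _ = _ := by field_simp
    exact absurd this (not_le.mpr h3)
  exact ⟨-n, hn, fun m hm => zpow_right_injective₀ hpos h1.ne (hm.symm.trans hn)⟩

/-- The normalised discrete valuation `v_F : Fˣ → ℤ` of a finite extension `F` of `ℚ_p`:
`v_F x` is the integer `m` with `‖x‖ = ‖ϖ‖ ^ m`, that is, with `x * ϖ ^ (-m)` a unit of the ring
of integers, where `ϖ` is a uniformizer. The norm of `F` is the unique one that extends the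
`p`-adic norm. -/
noncomputable def valF (p : ℕ) [Fact p.Prime] {F : Type*} [NormedField F]
    [NormedAlgebra ℚ_[p] F] [FiniteDimensional ℚ_[p] F] (x : Fˣ) : ℤ :=
  ((exists_isUniformizer p F).choose_spec.existsUnique_zpow x).choose

theorem IsUniformizer.norm_eq_zpow_valF (p : ℕ) [Fact p.Prime] {F : Type*} [NormedField F]
    [NormedAlgebra ℚ_[p] F] [FiniteDimensional ℚ_[p] F] {ϖ : F} (h : IsUniformizer ϖ)
    (x : Fˣ) : ‖(x : F)‖ = ‖ϖ‖ ^ valF p x := by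
  have hs := (exists_isUniformizer p F).choose_spec
  rw [le_antisymm (hs.2.2 ϖ h.2.1) (h.2.2 _ hs.2.1)]
  exact (hs.existsUnique_zpow x).choose_spec.1

end Valuation

/-! ### The group `H_{3,t}` -/

section Groups

/-- The unitriangular matrix with entries `a = x₁₂`, `b = x₂₃`, `c = x₁₃`, as an element of
`GL₃(F)`. -/
def unitri {F : Type*} [Field F] (a b c : F) : GL (Fin 3) F where
  val := !![1, a, c; 0, 1, b; 0, 0, 1]
  inv := !![1, -a, a * b - c; 0, 1, -b; 0, 0, 1]
  val_inv := by
    ext i j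
    fin_cases i <;> fin_cases j <;> simp [Matrix.mul_apply, Fin.sum_univ_three] <;> ring
  inv_val := by
    ext i j
    fin_cases i <;> fin_cases j <;> simp [Matrix.mul_apply, Fin.sum_univ_three] <;> ring

/-- The group `U₃(F)` of all upper unitriangular matrices in `GL₃(F)`. -/
def U3 (F : Type*) [Field F] : Subgroup (GL (Fin 3) F) where
  carrier := {g | ∃ a b c : F, g = unitri a b c}
  one_mem' := ⟨0, 0, 0, by
    ext i j
    fin_cases i <;> fin_cases j <;> simp [unitri]⟩
  mul_mem' := by
    rintro _ _ ⟨a, b, c, rfl⟩ ⟨a', b', c', rfl⟩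
    refine ⟨a + a', b + b', c + a * b' + c', ?_⟩
    ext i j
    fin_cases i <;> fin_cases j <;> simp [unitri, Matrix.mul_apply, Fin.sum_univ_three] <;> ring
  inv_mem' := by
    rintro _ ⟨a, b, c, rfl⟩
    refine ⟨-a, -b, a * b - c, ?_⟩
    rw [inv_eq_iff_mul_eq_one]
    ext i j
    fin_cases i <;> fin_cases j <;> simp [unitri, Matrix.mul_apply, Fin.sum_univ_three] <;> ring

/-- The diagonal matrix `t = diag(u, 1, v⁻¹)` in `GL₃(F)`. -/
def diagT {F : Type*} [Field F] (u v : Fˣ) : GL (Fin 3) F where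
  val := Matrix.diagonal ![(u : F), 1, ((v⁻¹ : Fˣ) : F)]
  inv := Matrix.diagonal ![((u⁻¹ : Fˣ) : F), 1, (v : F)]
  val_inv := by
    rw [Matrix.diagonal_mul_diagonal, ← Matrix.diagonal_one]
    congr 1
    ext i
    fin_cases i <;> simp
  inv_val := by
    rw [Matrix.diagonal_mul_diagonal, ← Matrix.diagonal_one]
    congr 1
    ext i
    fin_cases i <;> simp

/-- The group `H_{3,t} = ⟨t, U₃(F)⟩ ≤ GL₃(F)`, with the topology inherited from `GL₃(F)`. -/
def H3 {F : Type*} [Field F] (u v : Fˣ) : Subgroup (GL (Fin 3) F) :=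
  Subgroup.closure ({diagT u v} ∪ (U3 F : Set (GL (Fin 3) F)))

end Groups

/-!
Write `R = kG` for `G = H_{3,t}`, and let `I` be the left ideal of `R` generated by the elements
`h - 1`, where `h` runs over finitely many root elements of `U₃(F)`: one in the root group of `x₂₃`,
and topological generators of a lattice in the root group of `x₁₂`. If `R` were left coherent, the
left ideal `J = {μ | μ * (1 - t) ∈ I}` would be finitely generated (`fg_comap_toSpanSingleton`).
It is not, for the following reason.

Let `H` be a compact open subgroup of `U₃(F)` containing the elements `h`. Consider the graph with
vertex set `G / H` and an edge from `g H` to `g t H` for every `g`: each element of `J` gives a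
chain of edges without boundary. The graph maps to a line through the height `G → ℤ`, the exponent
of `t`. Let `P` be a compact open subgroup of `U₃(F)` that contains `t ^ i H t ^ (-i)` for
`1 ≤ i ≤ L`. Applying an element of `I` to the indicator function of `⋃ P * t ^ i`, over
`1 ≤ i ≤ L`, shows that every `μ ∈ J` has the same integral over `P` and over `P * t ^ L`
(`H3.integ_charFn_stripe_eq`). When the heights on the support of `μ` never differ by `L`, all
translates of `μ` thus have integral zero over `P`. Hence, if `J` is finitely generated, then for a
suitable `L` all its elements have integral zero over `P`
(`H3.exists_integ_charFn_stripe_eq_zero`).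

On the other hand, `u` contracts the root group of `x₁₂` and `v` expands that of `x₂₃`. So a
central element `z` of `U₃(F)`, chosen outside `P`, is both a commutator of elements from the groups
`t ^ i H t ^ (-i)` with `i ≥ 1` and a commutator of elements from those with `i ≤ 0`. This gives
a path from `t` to `z t` above height `0` and a path from `z` to `1` below, which close up to a cycle
that meets the edges of `U₃(F)` in `1 - z` only, and has integral `1` over `P`
(`AugIwasawa.exists_integ_charFn_eq_one`, `H3.exists_integ_charFn_stripe_ne_zero`).

The ideal `I` has finitely many generators but contains `x - 1` for all `x` in a lattice of a root
group; this is a duality argument on locally constant functions on `ℤ_p`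
(`AugIwasawa.dirac_sub_dirac_mem_span`). Right coherence is reduced to the same statement on
left ideals by the antipode `AugIwasawa.antipodeEquiv`, which is antimultiplicative by a Fubini
theorem (`AugIwasawa.integ_mul_swap`).
-/

/-! ### A consequence of coherence -/

/-- If the finitely generated submodules of `M` are finitely presented and `N` is one of them, then
the ideal `{a | a • x ∈ N}` is finitely generated: it is the image in `A` of the kernel of
`A × N → A • x + N`. Applied to `M = R` over `A = R` and over `A = Rᵐᵒᵖ`, this is the only
consequence of coherence that is needed. -/
theorem fg_comap_toSpanSingleton {A M : Type*} [Ring A] [AddCommGroup M] [Module A M]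
    (hM : ∀ N : Submodule A M, N.FG → Module.FinitePresentation A N)
    (x : M) {N : Submodule A M} (hN : N.FG) :
    (N.comap (LinearMap.toSpanSingleton A M x)).FG := by
  have hfg : (Submodule.span A {x} ⊔ N).FG := (Submodule.fg_span_singleton x).sup hN
  have := hM _ hfg
  have : Module.Finite A N := Module.Finite.iff_fg.mpr hN
  let g : A × N →ₗ[A] M := (LinearMap.toSpanSingleton A M x).coprod N.subtype
  have hg : ∀ z, g z ∈ Submodule.span A {x} ⊔ N := fun z =>
    Submodule.add_mem_sup (Submodule.smul_mem _ _ (Submodule.mem_span_singleton_self x)) z.2.2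
  let l : A × N →ₗ[A] (Submodule.span A {x} ⊔ N : Submodule A M) := g.codRestrict _ hg
  have hl : Function.Surjective l := by
    rintro ⟨m, hm⟩
    obtain ⟨y, hy, n, hn, rfl⟩ := Submodule.mem_sup.mp hm
    obtain ⟨a, rfl⟩ := Submodule.mem_span_singleton.mp hy
    exact ⟨(a, ⟨n, hn⟩), rfl⟩
  have hker := Module.FinitePresentation.fg_ker l hl
  convert hker.map (LinearMap.fst A A N) using 1
  ext a
  simp only [Submodule.mem_comap, LinearMap.toSpanSingleton_apply, Submodule.mem_map,
    LinearMap.mem_ker]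
  constructor
  · intro ha
    exact ⟨(a, -⟨a • x, ha⟩), Subtype.ext (by simp [l, g]), rfl⟩
  · rintro ⟨⟨b, n⟩, hb, rfl⟩
    have h : b • x + (n : M) = 0 := congrArg Subtype.val hb
    change b • x ∈ N
    rw [eq_neg_of_add_eq_zero_left h]
    exact N.neg_mem n.2

/-! ### Integration against compactly supported distributions -/

namespace AugIwasawa

set_option linter.unusedSectionVars false

variable {k G : Type*} [Field k] [Group G] [TopologicalSpace G] [IsTopologicalGroup G]

@[simp] theorem integ_sub (μ ν : AugIwasawa k G) (f : LocallyConstant G k) :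
    (μ - ν).integ f = μ.integ f - ν.integ f := rfl

theorem integ_dirac_mul (g : G) (μ : AugIwasawa k G) (f : LocallyConstant G k) :
    (dirac g * μ).integ f = μ.integ (translate g f) := rfl

theorem dirac_one : (dirac 1 : AugIwasawa k G) = 1 := rfl

theorem charFn_congr {X : Type*} [TopologicalSpace X] {P Q : Set X} (hP : IsClopen P)
    (hQ : IsClopen Q) {x y : X} (h : x ∈ P ↔ y ∈ Q) :
    LocallyConstant.charFn k hP x = LocallyConstant.charFn k hQ y := by
  classical
  simp only [LocallyConstant.coe_charFn, Set.indicator_apply, h, Pi.one_apply]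

theorem sum_smul_apply {X ι : Type*} [TopologicalSpace X] (T : Finset ι) (a : ι → k)
    (f : ι → LocallyConstant X k) (x : X) : (∑ c ∈ T, a c • f c) x = ∑ c ∈ T, a c * f c x :=
  map_sum (LocallyConstant.evalₗ k x) _ T

theorem integ_sum_smul {ι : Type*} (μ : AugIwasawa k G) (T : Finset ι) (a : ι → k)
    (f : ι → LocallyConstant G k) :
    μ.integ (∑ c ∈ T, a c • f c) = ∑ c ∈ T, a c * μ.integ (f c) := by
  rw [map_sum]
  exact Finset.sum_congr rfl fun c _ => map_smul μ.integ _ _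

variable (k) in
/-- The left ideal of `kG` generated by the elements `h - 1` with `h ∈ S`. -/
noncomputable def augIdeal (S : Set G) : Submodule (AugIwasawa k G) (AugIwasawa k G) :=
  Submodule.span (AugIwasawa k G) ((fun h => dirac h - 1) '' S)

theorem fg_augIdeal {S : Set G} (hS : S.Finite) : (augIdeal k S).FG :=
  Submodule.fg_span (hS.image _)

theorem integ_mul_dirac_sub_one (μ : AugIwasawa k G) (h : G) (f : LocallyConstant G k)
    (hf : ∀ x, f (x * h) = f x) : (μ * (dirac h - 1)).integ f = 0 := by
  have : (dirac h - 1 : AugIwasawa k G).inner f = 0 := by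
    ext x
    simp [integ_one, hf]
  rw [integ_mul, this, map_zero]

/-- Elements of `augIdeal k S` annihilate the functions that are right invariant under `S`. -/
theorem integ_eq_zero_of_mem_augIdeal {S : Set G} {f : LocallyConstant G k}
    (hf : ∀ h ∈ S, ∀ x, f (x * h) = f x) {μ : AugIwasawa k G}
    (hμ : μ ∈ augIdeal k S) : μ.integ f = 0 := by
  induction hμ using Submodule.closure_induction with
  | zero => rfl
  | add μ ν _ _ hμ hν => rw [integ_add, hμ, hν, add_zero]
  | smul_mem r x h =>
    obtain ⟨h, hS, rfl⟩ := h
    exact integ_mul_dirac_sub_one r h f (hf h hS)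

/-! ### One-parameter subgroups -/

section OneParameter

variable {p : ℕ} [Fact p.Prime]

/-- The difference operator `f ↦ (s ↦ f (s + 1) - f s)` on locally constant functions on `ℤ_p`. -/
noncomputable def shiftSub (p : ℕ) [Fact p.Prime] (k : Type*) [Field k] :
    LocallyConstant ℤ_[p] k →ₗ[k] LocallyConstant ℤ_[p] k :=
  LocallyConstant.comapₗ k ⟨fun s => s + 1, continuous_add_const 1⟩ - LinearMap.id

theorem eq_of_shiftSub_eq_zero {f : LocallyConstant ℤ_[p] k} (hf : shiftSub p k f = 0)
    (s : ℤ_[p]) : f s = f 0 := by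
  have hstep : ∀ s : ℤ_[p], f (s + 1) = f s := fun s => by
    have := DFunLike.congr_fun hf s
    exact sub_eq_zero.mp this
  have hnat : ∀ n : ℕ, f (n : ℤ_[p]) = f 0 := fun n => by
    induction n with
    | zero => simp
    | succ n ih => rw [Nat.cast_succ, hstep, ih]
  have hclosed : IsClosed {s | f s = f 0} := f.isLocallyConstant.isClosed_fiber (f 0)
  exact PadicInt.denseRange_natCast.induction_on s hclosed hnat

/-- If right translation by `g` moves the parameter `s` of `ι` to `s + 1`, then `ι s - ι 0` is a
left multiple of `g - 1` for every `s : ℤ_p`. The functional `f ↦ f s - f 0` on locally constant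
functions on `ℤ_p` vanishes on the kernel of the difference operator, hence factors through that
operator; the push-forward along `ι` of the resulting functional is the required cofactor. -/
theorem dirac_sub_dirac_mem_span {ι : ℤ_[p] → G} (hι : Continuous ι) {g : G}
    (hg : ∀ s, ι (s + 1) = ι s * g) (s : ℤ_[p]) :
    (dirac (ι s) - dirac (ι 0) : AugIwasawa k G) ∈
      Submodule.span (AugIwasawa k G) {(dirac g - 1 : AugIwasawa k G)} := by
  have hmem : (LocallyConstant.evalₗ k s - LocallyConstant.evalₗ k 0 :
      Module.Dual k (LocallyConstant ℤ_[p] k)) ∈ LinearMap.range (shiftSub p k).dualMap := by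
    rw [LinearMap.range_dualMap_eq_dualAnnihilator_ker, Submodule.mem_dualAnnihilator]
    intro f hf
    exact sub_eq_zero.mpr (eq_of_shiftSub_eq_zero hf s)
  obtain ⟨ν, hν⟩ := hmem
  let N : AugIwasawa k G := ⟨ν ∘ₗ LocallyConstant.comapₗ k ⟨ι, hι⟩, Set.range ι,
    isCompact_range hι, fun f hf => by
      have : LocallyConstant.comapₗ k ⟨ι, hι⟩ f = 0 := by
        ext s
        exact hf _ ⟨s, rfl⟩
      rw [LinearMap.comp_apply, this, map_zero]⟩
  rw [Submodule.mem_span_singleton]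
  refine ⟨N, ?_⟩
  ext f
  have key := LinearMap.congr_fun hν (f.comap ⟨ι, hι⟩)
  rw [smul_eq_mul, integ_mul]
  refine Eq.trans ?_ key
  change ν _ = ν _
  congr 1
  ext r
  change f (ι r * g) - f (ι r * 1) = f (ι (r + 1)) - f (ι r)
  rw [hg, mul_one]

end OneParameter

/-! ### The antipode -/

section Antipode

/-- Fubini: `∫ ∫ f (x * y) dν(y) dμ(x) = ∫ g dν` with `g y = ∫ f (x * y) dμ(x)`. By compactness of
the supports, `(x, y) ↦ f (x * y)` agrees there with a finite sum of products of a locally constant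
function of `x` and a locally constant function of `y`. -/
theorem integ_mul_swap (μ ν : AugIwasawa k G) (f g : LocallyConstant G k)
    (hg : ∀ y, g y = μ.integ (f.comap ⟨fun x => x * y, continuous_mul_const y⟩)) :
    (μ * ν).integ f = ν.integ g := by
  classical
  obtain ⟨K, hK, hμ⟩ := μ.exists_support
  obtain ⟨L, hL, hν⟩ := ν.exists_support
  -- `q` sends `x` to the restriction to `L` of `y ↦ f (x * y)`; it takes finitely many values on `K`
  let q : LocallyConstant G (L → k) := ⟨fun x y => f (x * y), by
    rw [IsLocallyConstant.iff_eventually_eq]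
    intro x
    have key : ∀ᶠ x' in 𝓝 x, ∀ y ∈ L, f (x' * y) = f (x * y) := by
      refine hL.eventually_forall_of_forall_eventually fun y _ => ?_
      have h1 : ∀ᶠ z : G × G in 𝓝 (x, y), f (z.1 * z.2) = f (x * y) :=
        (continuous_mul.tendsto (x, y)).eventually (f.isLocallyConstant.eventually_eq (x * y))
      have h2 : ∀ᶠ z : G × G in 𝓝 (x, y), f (x * z.2) = f (x * y) :=
        ((continuous_const.mul continuous_snd).tendsto (x, y)).eventually
          (f.isLocallyConstant.eventually_eq (x * y))
      filter_upwards [h1, h2] with z hz1 hz2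
      rw [hz1, hz2]
    filter_upwards [key] with x' hx'
    exact funext fun y => hx' y y.2⟩
  have hfin : (q '' K).Finite := by
    let _ : TopologicalSpace (L → k) := ⊥
    have : DiscreteTopology (L → k) := ⟨rfl⟩
    exact (hK.image q.isLocallyConstant.continuous).finite_of_discrete
  let rep : (L → k) → G := Function.invFun q
  have hrep : ∀ x, q (rep (q x)) = q x := fun x => Function.invFun_eq ⟨x, rfl⟩
  let ind : (L → k) → LocallyConstant G k := fun c => q.map fun d => if d = c then 1 else 0
  have hdec : ∀ x ∈ K, ∀ (φ : G → k), (∀ x x', q x = q x' → φ x = φ x') →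
      φ x = ∑ c ∈ hfin.toFinset, ind c x * φ (rep c) := by
    intro x hx φ hφ
    rw [Finset.sum_eq_single (q x)]
    · simp only [ind, LocallyConstant.map_apply, Function.comp_apply, if_true, one_mul]
      exact hφ _ _ (hrep x).symm
    · intro c _ hc
      simp [ind, hc.symm]
    · intro h
      exact absurd (hfin.mem_toFinset.mpr ⟨x, hx, rfl⟩) h
  rw [integ_mul, μ.integ_congr hμ
      (g := ∑ c ∈ hfin.toFinset, ν.integ (translate (rep c) f) • ind c),
    ν.integ_congr hν (g := ∑ c ∈ hfin.toFinset, μ.integ (ind c) • translate (rep c) f),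
    integ_sum_smul, integ_sum_smul]
  · exact Finset.sum_congr rfl fun c _ => mul_comm _ _
  · intro y hy
    rw [hg, μ.integ_congr hμ (g := ∑ c ∈ hfin.toFinset, f (rep c * y) • ind c),
      integ_sum_smul, sum_smul_apply]
    · exact Finset.sum_congr rfl fun c _ => mul_comm _ _
    · intro x hx
      rw [sum_smul_apply]
      refine (hdec x hx (fun x => f (x * y)) fun x x' h => congrFun h ⟨y, hy⟩).trans ?_
      exact Finset.sum_congr rfl fun c _ => mul_comm _ _
  · intro x hx
    rw [hdec x hx (ν.inner f) fun x x' h => ν.integ_congr hν fun y hy => congrFun h ⟨y, hy⟩,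
      sum_smul_apply]
    exact Finset.sum_congr rfl fun c _ => mul_comm _ _

/-- The push-forward of a distribution under inversion; it extends `g ↦ g⁻¹`. -/
def antipode (μ : AugIwasawa k G) : AugIwasawa k G :=
  ⟨μ.integ ∘ₗ LocallyConstant.comapₗ k ⟨fun x => x⁻¹, continuous_inv⟩, by
    obtain ⟨K, hK, hμ⟩ := μ.exists_support
    exact ⟨K⁻¹, hK.inv, fun f hf => hμ _ fun x hx => hf _ (Set.inv_mem_inv.mpr hx)⟩⟩

theorem integ_antipode (μ : AugIwasawa k G) (f : LocallyConstant G k) :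
    μ.antipode.integ f = μ.integ (f.comap ⟨fun x => x⁻¹, continuous_inv⟩) := rfl

theorem antipode_antipode (μ : AugIwasawa k G) : μ.antipode.antipode = μ := by
  ext f
  rw [integ_antipode, integ_antipode]
  congr 1
  ext x
  simp

theorem antipode_mul (μ ν : AugIwasawa k G) :
    (μ * ν).antipode = ν.antipode * μ.antipode := by
  ext f
  rw [integ_antipode, integ_mul ν.antipode, integ_antipode]
  refine integ_mul_swap μ ν _ _ fun y => ?_
  rw [LocallyConstant.coe_comap, Function.comp_apply, inner_apply, integ_antipode]
  congr 1
  ext x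
  simp

variable (k G) in
/-- The antipode as an isomorphism from `kG` to its opposite ring. -/
noncomputable def antipodeEquiv : AugIwasawa k G ≃+* (AugIwasawa k G)ᵐᵒᵖ where
  toFun μ := MulOpposite.op μ.antipode
  invFun μ := μ.unop.antipode
  left_inv μ := antipode_antipode μ
  right_inv μ := congrArg MulOpposite.op (antipode_antipode μ.unop)
  map_mul' μ ν := congrArg MulOpposite.op (antipode_mul μ ν)
  map_add' _ _ := rfl

end Antipode

/-! ### Filling modulo a left ideal -/

variable (k) in
/-- The additive subgroup of `kG` generated by the point masses at elements outside `N`. -/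
noncomputable def diracsOff (N : Subgroup G) : AddSubgroup (AugIwasawa k G) :=
  AddSubgroup.closure (dirac '' (N : Set G)ᶜ)

theorem dirac_mem_diracsOff {N : Subgroup G} {g : G} (hg : g ∉ N) :
    (dirac g : AugIwasawa k G) ∈ diracsOff k N :=
  AddSubgroup.subset_closure ⟨g, hg, rfl⟩

theorem dirac_mul_mem_diracsOff {N : Subgroup G} {w : G} (hw : w ∈ N) {a : AugIwasawa k G}
    (ha : a ∈ diracsOff k N) : dirac w * a ∈ diracsOff k N := by
  induction ha using AddSubgroup.closure_induction with
  | mem x hx =>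
    obtain ⟨g, hg, rfl⟩ := hx
    rw [dirac_mul_dirac]
    exact dirac_mem_diracsOff fun h => hg ((N.mul_mem_cancel_left hw).mp h)
  | zero => rw [mul_zero]; exact zero_mem _
  | add x y _ _ hx hy => rw [mul_add]; exact add_mem hx hy
  | neg x _ hx => rw [mul_neg]; exact neg_mem hx

theorem integ_charFn_of_mem_diracsOff {N : Subgroup G} {P : Set G} (hP : IsClopen P)
    (hPN : P ⊆ N) {a : AugIwasawa k G} (ha : a ∈ diracsOff k N) :
    a.integ (LocallyConstant.charFn k hP) = 0 := by
  induction ha using AddSubgroup.closure_induction with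
  | mem x hx =>
    obtain ⟨g, hg, rfl⟩ := hx
    exact (LocallyConstant.charFn_eq_zero _ g hP).mpr fun h => hg (hPN h)
  | zero => rfl
  | add x y _ _ hx hy => rw [integ_add, hx, hy, add_zero]
  | neg x _ hx =>
    change (-x.integ) _ = 0
    rw [LinearMap.neg_apply, hx, neg_zero]

theorem dirac_mul_sub_one_mem (I : Submodule (AugIwasawa k G) (AugIwasawa k G)) {g h : G}
    (hg : (dirac g - 1 : AugIwasawa k G) ∈ I) (hh : (dirac h - 1 : AugIwasawa k G) ∈ I) :
    (dirac (g * h) - 1 : AugIwasawa k G) ∈ I := by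
  have : (dirac (g * h) - 1 : AugIwasawa k G) =
      (dirac g : AugIwasawa k G) • (dirac h - 1 : AugIwasawa k G) + (dirac g - 1) := by
    rw [smul_eq_mul, mul_sub, dirac_mul_dirac, mul_one]
    abel
  rw [this]
  exact I.add_mem (I.smul_mem _ hh) hg

/-- The subgroup of those `w ∈ N` for which `(w - 1) * t ^ m` lies in `I + D * (1 - t)`, where `D` is
generated by the point masses outside `N`. If `I` is generated by the `h - 1` with `h` in a subgroup
`H`, this says that `w t ^ m H - t ^ m H` is the boundary of a chain of edges labelled by elements
outside `N`, in the graph with vertices `G / H` and an edge from `g H` to `g t H` for each `g`. -/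
def fillable (I : Submodule (AugIwasawa k G) (AugIwasawa k G)) (N : Subgroup G) (t : G) (m : ℤ) :
    Subgroup G where
  carrier := {w | w ∈ N ∧ ∃ a ∈ diracsOff k N,
    (dirac w - 1) * dirac (t ^ m) - a * (1 - dirac t) ∈ I}
  one_mem' := ⟨one_mem _, 0, zero_mem _, by simp [dirac_one]⟩
  mul_mem' := by
    rintro w w' ⟨hw, a, ha, h⟩ ⟨hw', a', ha', h'⟩
    refine ⟨mul_mem hw hw', dirac w * a' + a, add_mem (dirac_mul_mem_diracsOff hw ha') ha, ?_⟩
    have := I.add_mem (I.smul_mem (dirac w) h') h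
    convert this using 1
    rw [smul_eq_mul, ← dirac_mul_dirac]
    noncomm_ring
  inv_mem' := by
    rintro w ⟨hw, a, ha, h⟩
    refine ⟨inv_mem hw, -(dirac w⁻¹ * a), neg_mem (dirac_mul_mem_diracsOff (inv_mem hw) ha), ?_⟩
    have := I.smul_mem (-dirac w⁻¹) h
    convert this using 1
    have h1 : (dirac w⁻¹ * dirac w : AugIwasawa k G) = 1 := by
      rw [dirac_mul_dirac, inv_mul_cancel, dirac_one]
    have h2 : (dirac w⁻¹ * (dirac w * dirac (t ^ m)) : AugIwasawa k G) = dirac (t ^ m) := by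
      rw [← mul_assoc, h1, one_mul]
    rw [smul_eq_mul]
    simp only [mul_sub, sub_mul, neg_mul, one_mul, mul_one, h2, mul_assoc]
    abel

section Fillable

variable {I : Submodule (AugIwasawa k G) (AugIwasawa k G)} {N : Subgroup G} {t : G}

/-- The element `(w - 1) * t ^ m` lies in `diracsOff k N`, and multiplied by `1 - t` it accounts for
the difference between the levels `m` and `m + 1`. -/
theorem mem_fillable_succ_iff {m : ℤ} (hm : t ^ m ∉ N) {w : G} :
    w ∈ fillable I N t (m + 1) ↔ w ∈ fillable I N t m := by
  refine and_congr_right fun hw => ?_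
  have hb : (dirac w - 1) * dirac (t ^ m) ∈ diracsOff k N := by
    rw [sub_mul, one_mul]
    exact sub_mem (dirac_mul_mem_diracsOff hw (dirac_mem_diracsOff hm)) (dirac_mem_diracsOff hm)
  have ht : (dirac (t ^ (m + 1)) : AugIwasawa k G) = dirac (t ^ m) * dirac t := by
    rw [dirac_mul_dirac, zpow_add_one]
  constructor
  · rintro ⟨a, ha, h⟩
    refine ⟨(dirac w - 1) * dirac (t ^ m) + a, add_mem hb ha, ?_⟩
    convert h using 1
    rw [ht]
    noncomm_ring
  · rintro ⟨a, ha, h⟩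
    refine ⟨a - (dirac w - 1) * dirac (t ^ m), sub_mem ha hb, ?_⟩
    convert h using 1
    rw [ht]
    noncomm_ring

theorem mem_fillable_of_mul_eq {m : ℤ} {w h : G} (hw : w ∈ N) (hh : dirac h - 1 ∈ I)
    (hwh : w * t ^ m = t ^ m * h) : w ∈ fillable I N t m := by
  refine ⟨hw, 0, zero_mem _, ?_⟩
  rw [zero_mul, sub_zero, sub_mul, dirac_mul_dirac, hwh, one_mul, ← dirac_mul_dirac]
  convert I.smul_mem (dirac (t ^ m)) hh using 1
  rw [smul_eq_mul, mul_sub, mul_one]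

/-- Conjugates `t ^ m * h * t ^ (-m)` with `m ≥ 1` can be filled above level `1`. -/
theorem mem_fillable_one (ht : ∀ m : ℤ, m ≠ 0 → t ^ m ∉ N) {w h : G} (n : ℕ) (hw : w ∈ N)
    (hh : dirac h - 1 ∈ I) (hwh : w * t ^ (n + 1) = t ^ (n + 1) * h) :
    w ∈ fillable I N t 1 := by
  have h0 : w ∈ fillable I N t (n + 1) := mem_fillable_of_mul_eq hw hh (by exact_mod_cast hwh)
  clear hwh
  induction n with
  | zero => simpa using h0
  | succ n ih =>
    exact ih ((mem_fillable_succ_iff (ht _ (by omega))).mp (by exact_mod_cast h0))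

/-- Conjugates `t ^ (-m) * h * t ^ m` with `m ≥ 0` can be filled below level `0`. -/
theorem mem_fillable_zero (ht : ∀ m : ℤ, m ≠ 0 → t ^ m ∉ N) {w h : G} (n : ℕ) (hw : w ∈ N)
    (hh : dirac h - 1 ∈ I) (hwh : t ^ n * w = h * t ^ n) :
    w ∈ fillable I N t 0 := by
  have h0 : w ∈ fillable I N t (-n) := mem_fillable_of_mul_eq hw hh (by
    rw [zpow_neg, zpow_natCast, eq_inv_mul_iff_mul_eq, ← mul_assoc, hwh, mul_inv_cancel_right])
  clear hwh
  induction n with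
  | zero => simpa using h0
  | succ n ih =>
    refine ih ?_
    have := (mem_fillable_succ_iff (ht (-(n + 1 : ℕ)) (by omega))).mpr h0
    convert this using 1
    push_cast
    ring_nf

/-- Joining a path from `z` to `1` below level `0` with one from `t` to `z * t` above level `1` gives
a cycle `c` whose part inside `N` is `1 - z`. -/
theorem exists_integ_charFn_eq_one {z : G} (h0 : z ∈ fillable I N t 0)
    (h1 : z ∈ fillable I N t 1) :
    ∃ c : AugIwasawa k G, c * (1 - dirac t) ∈ I ∧ ∀ (P : Set G) (hP : IsClopen P), P ⊆ N →
      1 ∈ P → z ∉ P → c.integ (LocallyConstant.charFn k hP) = 1 := by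
  obtain ⟨-, a, ha, h0⟩ := h0
  obtain ⟨-, b, hb, h1⟩ := h1
  rw [zpow_zero, dirac_one, mul_one] at h0
  rw [zpow_one] at h1
  refine ⟨1 - dirac z + a - b, ?_, fun P hP hPN h1P hzP => ?_⟩
  · convert I.sub_mem h1 h0 using 1
    noncomm_ring
  · rw [integ_sub, integ_add, integ_sub, integ_charFn_of_mem_diracsOff hP hPN ha,
      integ_charFn_of_mem_diracsOff hP hPN hb, integ_one, integ_dirac,
      (LocallyConstant.charFn_eq_one _ 1 hP).mpr h1P, (LocallyConstant.charFn_eq_zero _ z hP).mpr hzP]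
    ring

end Fillable

end AugIwasawa

/-! ### Matrices in `H_{3,t}` -/

theorem unitri_mul_unitri {F : Type*} [Field F] (a b c a' b' c' : F) :
    unitri a b c * unitri a' b' c' = unitri (a + a') (b + b') (c + a * b' + c') := by
  ext i j
  fin_cases i <;> fin_cases j <;>
    simp [unitri, Matrix.mul_apply, Fin.sum_univ_three] <;> ring

theorem diagT_mul_unitri {F : Type*} [Field F] (u v : Fˣ) (a b c : F) :
    diagT u v * unitri a b c = unitri (u * a) (v * b) (u * v * c) * diagT u v := by
  ext i j
  fin_cases i <;> fin_cases j <;>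
    simp [unitri, diagT, Matrix.mul_apply, Matrix.diagonal_apply, mul_comm, mul_assoc,
      mul_left_comm]

theorem diagT_pow_mul_unitri {F : Type*} [Field F] (u v : Fˣ) (n : ℕ) (a b c : F) :
    diagT u v ^ n * unitri a b c =
      unitri (u ^ n * a) (v ^ n * b) ((u * v) ^ n * c) * diagT u v ^ n := by
  induction n generalizing a b c with
  | zero => simp
  | succ n ih =>
    rw [pow_succ, mul_assoc, diagT_mul_unitri, ← mul_assoc, ih, mul_assoc]
    congr 2 <;> ring

theorem continuous_unitri {F : Type*} [Field F] [TopologicalSpace F] [IsTopologicalRing F]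
    {X : Type*} [TopologicalSpace X] {a b c : X → F} (ha : Continuous a) (hb : Continuous b)
    (hc : Continuous c) : Continuous fun x => unitri (a x) (b x) (c x) := by
  rw [Units.continuous_iff]
  constructor <;> refine continuous_matrix fun i j => ?_ <;>
    fin_cases i <;> fin_cases j <;> simp [unitri] <;> fun_prop

namespace H3

section Algebra

variable {F : Type*} [Field F] {u v : Fˣ}

variable (u v) in
/-- The matrix `diag(u, 1, v⁻¹)` as an element of `H_{3,t}`. -/
def t : H3 u v := ⟨diagT u v, Subgroup.subset_closure (Or.inl rfl)⟩

variable (u v) in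
/-- The unitriangular matrices as elements of `H_{3,t}`. -/
def uni (a b c : F) : H3 u v :=
  ⟨unitri a b c, Subgroup.subset_closure (Or.inr ⟨a, b, c, rfl⟩)⟩

/-- The matrix entries of an element of `H_{3,t}`. -/
def entry (g : H3 u v) (i j : Fin 3) : F := (g : GL (Fin 3) F).val i j

theorem entry_mul (g h : H3 u v) (i j : Fin 3) :
    entry (g * h) i j = entry g i 0 * entry h 0 j + entry g i 1 * entry h 1 j +
      entry g i 2 * entry h 2 j := by
  simp [entry, Matrix.mul_apply, Fin.sum_univ_three]

/-- All elements of `H_{3,t}` are upper triangular with middle diagonal entry `1`. -/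
theorem entry_spec (g : H3 u v) :
    entry g 1 0 = 0 ∧ entry g 2 0 = 0 ∧ entry g 1 1 = 1 ∧ entry g 2 1 = 0 := by
  obtain ⟨g, hg⟩ := g
  simp only [entry]
  induction hg using Subgroup.closure_induction_right with
  | one => simp
  | mul_right x hx y hy ih =>
    obtain ⟨h1, h2, h3, h4⟩ := ih
    rcases hy with rfl | ⟨a, b, c, rfl⟩ <;>
      simp [diagT, unitri, Matrix.mul_apply, Fin.sum_univ_three, h1, h2, h3, h4,
        Matrix.diagonal_apply]
  | mul_inv_cancel x hx y hy ih =>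
    obtain ⟨h1, h2, h3, h4⟩ := ih
    rcases hy with rfl | ⟨a, b, c, rfl⟩ <;>
      simp [diagT, unitri, Matrix.mul_apply, Fin.sum_univ_three, h1, h2, h3, h4,
        Matrix.diagonal_apply, Units.inv_mk, -Matrix.coe_units_inv]

theorem uni_mul_uni (a b c a' b' c' : F) :
    uni u v a b c * uni u v a' b' c' = uni u v (a + a') (b + b') (c + a * b' + c') :=
  Subtype.ext (unitri_mul_unitri ..)

theorem t_pow_mul_uni (n : ℕ) (a b c : F) :
    t u v ^ n * uni u v a b c =
      uni u v (u ^ n * a) (v ^ n * b) ((u * v) ^ n * c) * t u v ^ n :=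
  Subtype.ext (diagT_pow_mul_unitri ..)

/-- The central matrix with entry `a * b` is the commutator of the root elements with entries `a`
and `b`. -/
theorem uni_zero_zero_mul_mem {K : Subgroup (H3 u v)} {a b : F} (ha : uni u v a 0 0 ∈ K)
    (hb : uni u v 0 b 0 ∈ K) : uni u v 0 0 (a * b) ∈ K := by
  have : uni u v 0 0 (a * b) =
      uni u v a 0 0 * uni u v 0 b 0 * (uni u v a 0 0)⁻¹ * (uni u v 0 b 0)⁻¹ := by
    rw [eq_mul_inv_iff_mul_eq, eq_mul_inv_iff_mul_eq]
    simp [uni_mul_uni]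
  rw [this]
  exact mul_mem (mul_mem (mul_mem ha hb) (inv_mem ha)) (inv_mem hb)

theorem entry_mul_zero (g h : H3 u v) : entry (g * h) 0 0 = entry g 0 0 * entry h 0 0 := by
  obtain ⟨h1, h2, -, -⟩ := entry_spec h
  rw [entry_mul, h1, h2]
  ring

@[simp] theorem entry_one_zero : entry (1 : H3 u v) 0 0 = 1 := by
  simp [entry]

theorem entry_mul_t (g : H3 u v) (i : Fin 3) :
    entry (g * t u v) i 0 = entry g i 0 * u ∧ entry (g * t u v) i 1 = entry g i 1 ∧
      entry (g * t u v) i 2 = entry g i 2 * (v : F)⁻¹ := by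
  simp only [entry_mul]
  simp [entry, t, diagT]

theorem entry_mul_uni (g : H3 u v) (a b c : F) (i : Fin 3) :
    entry (g * uni u v a b c) i 0 = entry g i 0 ∧
      entry (g * uni u v a b c) i 1 = entry g i 0 * a + entry g i 1 ∧
      entry (g * uni u v a b c) i 2 = entry g i 0 * c + entry g i 1 * b + entry g i 2 := by
  simp only [entry_mul]
  simp [entry, uni, unitri]

end Algebra

open AugIwasawa

variable {F : Type*} [NormedField F] {u v : Fˣ}

theorem continuous_entry (i j : Fin 3) : Continuous fun g : H3 u v => entry g i j :=
  (Units.continuous_val.comp continuous_subtype_val).matrix_elem i j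

theorem continuous_uni {X : Type*} [TopologicalSpace X] {a b c : X → F} (ha : Continuous a)
    (hb : Continuous b) (hc : Continuous c) : Continuous fun x => uni u v (a x) (b x) (c x) :=
  (continuous_unitri ha hb hc).subtype_mk _

variable (u v) in
/-- The homomorphism `g ↦ ‖g₁₁‖`, which sends `t` to `‖u‖` and the unitriangular matrices to `1`. It
serves as a height function on `H_{3,t}`. -/
noncomputable def scale : H3 u v →* ℝ where
  toFun g := ‖entry g 0 0‖
  map_one' := by simp
  map_mul' g h := by rw [entry_mul_zero, norm_mul]

theorem scale_apply (g : H3 u v) : scale u v g = ‖entry g 0 0‖ := rfl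

theorem scale_pos (g : H3 u v) : 0 < scale u v g := by
  have h : scale u v g * scale u v g⁻¹ = 1 := by rw [← map_mul, mul_inv_cancel, map_one]
  exact lt_of_le_of_ne (norm_nonneg (entry g 0 0)) (Ne.symm (left_ne_zero_of_mul_eq_one h))

theorem continuous_scale : Continuous (scale u v) :=
  (continuous_entry (u := u) (v := v) 0 0).norm

theorem scale_uni (a b c : F) : scale u v (uni u v a b c) = 1 := by
  simp [scale_apply, entry, uni, unitri]

theorem scale_t : scale u v (t u v) = ‖(u : F)‖ := by
  simp [scale_apply, entry, t, diagT]

theorem t_zpow_notMem (hu : ‖(u : F)‖ < 1) (m : ℤ) (hm : m ≠ 0) :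
    t u v ^ m ∉ (scale u v).ker := by
  have h0 : 0 < ‖(u : F)‖ := norm_pos_iff.mpr u.ne_zero
  have key : ∀ n : ℕ, n ≠ 0 → t u v ^ n ∉ (scale u v).ker := fun n hn h => by
    rw [MonoidHom.mem_ker, map_pow, scale_t] at h
    exact (pow_lt_one₀ h0.le hu hn).ne h
  obtain ⟨n, rfl | rfl⟩ := m.eq_nat_or_neg
  · rw [zpow_natCast]
    exact key n (by simpa using hm)
  · rw [zpow_neg, zpow_natCast, inv_mem_iff]
    exact key n (by simpa using hm)

/-! ### Locally constant functions detecting cycles -/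

variable (u v) in
/-- For `‖u‖ < 1`, the coset `P * t ^ i` of the compact open group `P` of unitriangular matrices with
`‖x₁₂‖ ≤ ρ‖u‖`, `‖x₂₃‖ ≤ ‖v‖ ^ L` and `‖x₁₃‖ ≤ ρ‖u‖‖v‖ ^ L`. If `g = x * t ^ i`, then
`x₁₂ = g₁₂`, `x₂₃ = g₂₃ * v ^ i` and `x₁₃ = g₁₃ * v ^ i`. Rows and columns are numbered from `1`
here, and from `0` in `entry`. -/
def stripe (ρ : ℝ) (L i : ℕ) : Set (H3 u v) :=
  {g | scale u v g = ‖(u : F)‖ ^ i ∧ ‖entry g 0 1‖ ≤ ρ * ‖(u : F)‖ ∧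
    ‖entry g 1 2‖ * ‖(v : F)‖ ^ i ≤ ‖(v : F)‖ ^ L ∧
    ‖entry g 0 2‖ * ‖(v : F)‖ ^ i ≤ ρ * ‖(u : F)‖ * ‖(v : F)‖ ^ L}

theorem isClopen_norm_le [IsUltrametricDist F] {X : Type*} [TopologicalSpace X] {f : X → F}
    (hf : Continuous f) {r : ℝ} (hr : 0 < r) : IsClopen {x | ‖f x‖ ≤ r} := by
  convert (IsUltrametricDist.isClopen_closedBall (0 : F) hr.ne').preimage hf using 1
  ext x
  simp

theorem isClopen_norm_eq [IsUltrametricDist F] {X : Type*} [TopologicalSpace X] {f : X → F}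
    (hf : Continuous f) {r : ℝ} (hr : 0 < r) : IsClopen {x | ‖f x‖ = r} := by
  convert (IsUltrametricDist.isClopen_sphere (0 : F) hr.ne').preimage hf using 1
  ext x
  simp

theorem isClopen_stripe [IsUltrametricDist F] {ρ : ℝ} (hρ : 0 < ρ) (L i : ℕ) :
    IsClopen (stripe u v ρ L i) := by
  have hu : 0 < ‖(u : F)‖ := norm_pos_iff.mpr u.ne_zero
  have hv : 0 < ‖(v : F)‖ := norm_pos_iff.mpr v.ne_zero
  have hvi : 0 < ‖(v : F)‖ ^ i := pow_pos hv i
  convert (isClopen_norm_eq (continuous_entry (u := u) (v := v) 0 0) (pow_pos hu i)).inter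
    ((isClopen_norm_le (continuous_entry (u := u) (v := v) 0 1) (mul_pos hρ hu)).inter
    ((isClopen_norm_le (continuous_entry (u := u) (v := v) 1 2)
      (div_pos (pow_pos hv L) hvi)).inter
    (isClopen_norm_le (continuous_entry (u := u) (v := v) 0 2)
      (div_pos (mul_pos (mul_pos hρ hu) (pow_pos hv L)) hvi)))) using 1
  ext g
  simp only [stripe, Set.mem_ofPred_eq, Set.mem_inter_iff, le_div_iff₀ hvi, scale_apply]

theorem mul_t_mem_stripe_iff {ρ : ℝ} {L i : ℕ} {g : H3 u v} :
    g * t u v ∈ stripe u v ρ L (i + 1) ↔ g ∈ stripe u v ρ L i := by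
  have hu : ‖(u : F)‖ ≠ 0 := norm_ne_zero_iff.mpr u.ne_zero
  have hv : ‖(v : F)‖ ≠ 0 := norm_ne_zero_iff.mpr v.ne_zero
  obtain ⟨-, h01, h02⟩ := entry_mul_t g 0
  obtain ⟨-, -, h12⟩ := entry_mul_t g 1
  have key : ∀ x : F, ‖x * (v : F)⁻¹‖ * ‖(v : F)‖ ^ (i + 1) = ‖x‖ * ‖(v : F)‖ ^ i := fun x => by
    rw [norm_mul, norm_inv, pow_succ']
    field_simp
  simp only [stripe, Set.mem_ofPred_eq, h01, h02, h12, key, map_mul, scale_t]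
  rw [pow_succ, mul_left_inj' hu]

theorem mul_uni_mem_stripe_of_norm_le [IsUltrametricDist F] {ρ : ℝ} {L i : ℕ} (hi : i ≠ 0)
    (hu : ‖(u : F)‖ < 1) {a : F} (ha : ‖a‖ ≤ ρ) {g : H3 u v} (hg : g ∈ stripe u v ρ L i) :
    g * uni u v a 0 0 ∈ stripe u v ρ L i := by
  obtain ⟨h0, h1, h2, h3⟩ := hg
  obtain ⟨-, h01, h02⟩ := entry_mul_uni g a 0 0 0
  obtain ⟨-, -, h12⟩ := entry_mul_uni g a 0 0 1
  simp only [mul_zero, zero_add] at h02 h12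
  refine ⟨by rw [map_mul, scale_uni, mul_one, h0], ?_, by rwa [h12], by rwa [h02]⟩
  rw [h01]
  refine (IsUltrametricDist.norm_add_le_max _ _).trans (max_le ?_ h1)
  rw [norm_mul, ← scale_apply, h0, mul_comm]
  have hρ : 0 ≤ ρ := (norm_nonneg a).trans ha
  have : ‖(u : F)‖ ^ i ≤ ‖(u : F)‖ := pow_le_of_le_one (norm_nonneg _) hu.le hi
  gcongr

theorem mul_uni_one_mem_stripe [IsUltrametricDist F] {ρ : ℝ} (hρ : 0 ≤ ρ) {L i : ℕ} (hiL : i ≤ L)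
    (hv : 1 < ‖(v : F)‖) {b : F} (hb : ‖b‖ ≤ 1) {g : H3 u v} (hg : g ∈ stripe u v ρ L i) :
    g * uni u v 0 b 0 ∈ stripe u v ρ L i := by
  obtain ⟨h0, h1, h2, h3⟩ := hg
  obtain ⟨-, -, e11, -⟩ := entry_spec g
  obtain ⟨-, h01, h02⟩ := entry_mul_uni g 0 b 0 0
  obtain ⟨-, -, h12⟩ := entry_mul_uni g 0 b 0 1
  simp only [mul_zero, zero_add, e11, one_mul] at h01 h02 h12
  have hvi : 0 ≤ ‖(v : F)‖ ^ i := by positivity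
  have hviL : ‖(v : F)‖ ^ i ≤ ‖(v : F)‖ ^ L := pow_le_pow_right₀ hv.le hiL
  refine ⟨by rw [map_mul, scale_uni, mul_one, h0], by rwa [h01], ?_, ?_⟩
  · rw [h12]
    refine (mul_le_mul_of_nonneg_right (IsUltrametricDist.norm_add_le_max _ _) hvi).trans ?_
    rw [max_mul_of_nonneg _ _ hvi]
    exact max_le ((mul_le_of_le_one_left hvi hb).trans hviL) h2
  · rw [h02]
    refine (mul_le_mul_of_nonneg_right (IsUltrametricDist.norm_add_le_max _ _) hvi).trans ?_
    rw [max_mul_of_nonneg _ _ hvi]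
    refine max_le ?_ h3
    rw [norm_mul]
    have : ‖entry g 0 1‖ * ‖b‖ ≤ ρ * ‖(u : F)‖ :=
      (mul_le_of_le_one_right (norm_nonneg _) hb).trans h1
    gcongr

variable (u v) in
/-- Root elements of `U₃(F)`: the one with `x₂₃ = 1`, and those with `x₁₂ = 1` and `x₁₂ = e i`. -/
def gens {ι : Type*} (e : ι → F) : Set (H3 u v) :=
  insert (uni u v 0 1 0) (insert (uni u v 1 0 0) (Set.range fun i => uni u v (e i) 0 0))

theorem uni_mul_uni_neg (a b : F) (h : a = 0 ∨ b = 0) :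
    uni u v a b 0 * uni u v (-a) (-b) 0 = 1 := by
  rw [uni_mul_uni]
  apply Subtype.ext
  ext i j
  fin_cases i <;> fin_cases j <;> rcases h with rfl | rfl <;> simp [uni, unitri]

/-- At the levels `1 ≤ i ≤ L`, the set `P * t ^ i` is right invariant under `gens u v e`, since `P`
contains the conjugates of these elements by `t ^ i`. -/
theorem mul_gens_mem_stripe_iff [IsUltrametricDist F] {ι : Type*} {e : ι → F} {ρ : ℝ}
    (hρ : 1 ≤ ρ) (he : ∀ i, ‖e i‖ ≤ ρ) {L i : ℕ} (hi : i ≠ 0) (hiL : i ≤ L)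
    (hu : ‖(u : F)‖ < 1) (hv : 1 < ‖(v : F)‖) {h : H3 u v} (hh : h ∈ gens u v e) (g : H3 u v) :
    g * h ∈ stripe u v ρ L i ↔ g ∈ stripe u v ρ L i := by
  have hx : ∀ a : F, ‖a‖ ≤ ρ → (g * uni u v a 0 0 ∈ stripe u v ρ L i ↔
      g ∈ stripe u v ρ L i) := fun a ha => by
    refine ⟨fun hg => ?_, mul_uni_mem_stripe_of_norm_le hi hu ha⟩
    have := mul_uni_mem_stripe_of_norm_le hi hu (a := -a) (by rwa [norm_neg]) hg
    have h1 := uni_mul_uni_neg (u := u) (v := v) a 0 (Or.inr rfl)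
    rw [neg_zero] at h1
    rwa [mul_assoc, h1, mul_one] at this
  rcases hh with rfl | rfl | ⟨j, rfl⟩
  · refine ⟨fun hg => ?_, mul_uni_one_mem_stripe (by linarith) hiL hv (by simp)⟩
    have := mul_uni_one_mem_stripe (by linarith) hiL hv (b := -1) (by simp) hg
    have h1 := uni_mul_uni_neg (u := u) (v := v) 0 1 (Or.inl rfl)
    rw [neg_zero] at h1
    rwa [mul_assoc, h1, mul_one] at this
  · exact hx 1 (by simpa using hρ)
  · exact hx _ (he j)

theorem exists_scale_ne (hu : ‖(u : F)‖ < 1) {K : Set (H3 u v)} (hK : IsCompact K) :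
    ∃ L : ℕ, ∀ x ∈ K, ∀ y ∈ K, scale u v y ≠ ‖(u : F)‖ ^ L * scale u v x := by
  rcases K.eq_empty_or_nonempty with rfl | hne
  · exact ⟨0, fun x hx => hx.elim⟩
  obtain ⟨a, -, ha⟩ := hK.exists_isMinOn hne continuous_scale.continuousOn
  obtain ⟨b, -, hb⟩ := hK.exists_isMaxOn hne continuous_scale.continuousOn
  obtain ⟨L, hL⟩ := exists_pow_lt_of_lt_one (div_pos (scale_pos a) (scale_pos b)) hu
  refine ⟨L, fun x hx y hy h => ?_⟩
  rw [lt_div_iff₀ (scale_pos b)] at hL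
  have h1 : scale u v a ≤ scale u v y := ha hy
  have h2 : scale u v x ≤ scale u v b := hb hx
  have h3 : ‖(u : F)‖ ^ L * scale u v x ≤ ‖(u : F)‖ ^ L * scale u v b := by gcongr
  linarith

section Window

variable {k : Type*} [Field k] [IsUltrametricDist F] {ι : Type*} {e : ι → F} {ρ : ℝ}

/-- If `μ * (1 - t)` lies in the ideal, then `μ` has the same integral over `P` and `P * t ^ L`:
with `φ` the indicator function of the union of the `P * t ^ i` for `1 ≤ i ≤ L`, the difference
`φ x - φ (x * t)` is the indicator of `P * t ^ L` minus that of `P`. -/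
theorem integ_charFn_stripe_eq (hρ : 1 ≤ ρ) (he : ∀ i, ‖e i‖ ≤ ρ) (hu : ‖(u : F)‖ < 1)
    (hv : 1 < ‖(v : F)‖) (L : ℕ) {μ : AugIwasawa k (H3 u v)}
    (hμ : μ * (1 - dirac (t u v)) ∈ augIdeal k (gens u v e)) :
    μ.integ (LocallyConstant.charFn k (isClopen_stripe (zero_lt_one.trans_le hρ) L 0)) =
      μ.integ (LocallyConstant.charFn k (isClopen_stripe (zero_lt_one.trans_le hρ) L L)) := by
  let χ : ℕ → LocallyConstant (H3 u v) k := fun i =>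
    LocallyConstant.charFn k (isClopen_stripe (zero_lt_one.trans_le hρ) L i)
  let φ : LocallyConstant (H3 u v) k := ∑ i ∈ Finset.range L, (1 : k) • χ (i + 1)
  have hφ : ∀ x, φ x = ∑ i ∈ Finset.range L, χ (i + 1) x := fun x => by
    simp only [φ, sum_smul_apply, one_mul]
  have h0 := integ_eq_zero_of_mem_augIdeal (f := φ) (fun h hh x => by
    rw [hφ, hφ]
    refine Finset.sum_congr rfl fun i hi => charFn_congr _ _ ?_
    exact mul_gens_mem_stripe_iff hρ he (Nat.succ_ne_zero i)
      (Nat.succ_le_of_lt (Finset.mem_range.mp hi)) hu hv hh x) hμ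
  have h1 : (1 - dirac (t u v) : AugIwasawa k (H3 u v)).inner φ = χ L - χ 0 := by
    ext x
    rw [inner_apply, integ_sub, integ_one, integ_dirac, AugIwasawa.translate_apply,
      AugIwasawa.translate_apply, mul_one,
      hφ, hφ, ← Finset.sum_sub_distrib, LocallyConstant.sub_apply,
      ← Finset.sum_range_sub (fun i => χ i x)]
    refine Finset.sum_congr rfl fun i _ => congrArg₂ _ rfl (charFn_congr _ _ ?_)
    exact mul_t_mem_stripe_iff
  rw [integ_mul, h1, map_sub, sub_eq_zero] at h0
  exact h0.symm

/-- If `J` is generated by finitely many `r`, then for some `L` the scales occurring in the supports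
of the `r` never differ by `‖u‖ ^ L`. So each translate of `r` misses `P` or `P * t ^ L`, and
has integral `0` over both. -/
theorem exists_integ_charFn_stripe_eq_zero (hρ : 1 ≤ ρ) (he : ∀ i, ‖e i‖ ≤ ρ)
    (hu : ‖(u : F)‖ < 1) (hv : 1 < ‖(v : F)‖)
    {J : Submodule (AugIwasawa k (H3 u v)) (AugIwasawa k (H3 u v))} (hJ : J.FG)
    (hJI : ∀ μ ∈ J, μ * (1 - dirac (t u v)) ∈ augIdeal k (gens u v e)) :
    ∃ L : ℕ, ∀ μ ∈ J, μ.integ (LocallyConstant.charFn k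
      (isClopen_stripe (zero_lt_one.trans_le hρ) L 0)) = 0 := by
  obtain ⟨T, rfl⟩ := hJ
  choose supp hsupp hdist using fun μ : AugIwasawa k (H3 u v) => μ.exists_support
  obtain ⟨L, hL⟩ := exists_scale_ne hu (T.finite_toSet.isCompact_biUnion fun μ _ => hsupp μ)
  refine ⟨L, fun μ hμ => ?_⟩
  induction hμ using Submodule.closure_induction with
  | zero => rfl
  | add μ ν _ _ hμ hν => rw [integ_add, hμ, hν, add_zero]
  | smul_mem s r hr =>
    have hzero : ∀ {i : ℕ} (g : H3 u v),
        (∀ x ∈ supp r, scale u v g * scale u v x ≠ ‖(u : F)‖ ^ i) →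
        r.integ (translate g (LocallyConstant.charFn k
          (isClopen_stripe (u := u) (v := v) (zero_lt_one.trans_le hρ) L i))) = 0 := by
      intro i g hg
      refine hdist r _ fun x hx => ?_
      rw [AugIwasawa.translate_apply, LocallyConstant.charFn_eq_zero]
      intro h
      exact hg x hx ((map_mul (scale u v) g x).symm.trans h.1)
    have hinner : r.inner (LocallyConstant.charFn k
        (isClopen_stripe (u := u) (v := v) (zero_lt_one.trans_le hρ) L 0)) = 0 := by
      ext g
      rw [inner_apply]
      by_cases hg : ∃ x ∈ supp r, scale u v g * scale u v x = 1
      · obtain ⟨x, hx, hgx⟩ := hg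
        have heq := integ_charFn_stripe_eq hρ he hu hv L (hJI (dirac g * r)
          (Submodule.smul_mem _ _ (Submodule.subset_span hr)))
        rw [integ_dirac_mul, integ_dirac_mul] at heq
        rw [heq]
        refine hzero g fun y hy hgy => hL x (Set.mem_biUnion hr hx) y (Set.mem_biUnion hr hy) ?_
        -- both `x` and `y` are moved by `g`, the first to scale `1`, the second to scale `‖u‖ ^ L`
        rw [← hgy, mul_right_comm, hgx, one_mul]
      · push Not at hg
        exact hzero g fun x hx => by simpa using hg x hx
    rw [smul_eq_mul, integ_mul, hinner, map_zero]

end Window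

/-! ### Cycles crossing the unipotent level -/

section Cycle

variable {p : ℕ} [Fact p.Prime] [NormedAlgebra ℚ_[p] F] {k : Type*} [Field k]

/-- The ideal contains `x - 1` for every root element `x` whose entry `x₁₂` lies in the `ℤ_p`-lattice
spanned by the `e i`. -/
theorem dirac_uni_sub_one_mem {ι : Type*} [Fintype ι] {e : ι → F} (s : ι → ℤ_[p]) :
    (dirac (uni u v (∑ i, (s i : ℚ_[p]) • e i) 0 0) - 1 : AugIwasawa k (H3 u v)) ∈
      augIdeal k (gens u v e) := by
  classical
  suffices h : ∀ T : Finset ι,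
      (dirac (uni u v (∑ i ∈ T, (s i : ℚ_[p]) • e i) 0 0) - 1 : AugIwasawa k (H3 u v)) ∈
        augIdeal k (gens u v e) from h Finset.univ
  have hone : uni u v 0 0 0 = 1 := by
    simpa [uni_mul_uni] using uni_mul_uni_neg (u := u) (v := v) 0 0 (Or.inl rfl)
  intro T
  induction T using Finset.induction_on with
  | empty => simp [hone, dirac_one]
  | insert i T hi ih =>
    have hmul : uni u v (∑ j ∈ insert i T, (s j : ℚ_[p]) • e j) 0 0 =
        uni u v ((s i : ℚ_[p]) • e i) 0 0 * uni u v (∑ j ∈ T, (s j : ℚ_[p]) • e j) 0 0 := by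
      simp [uni_mul_uni, Finset.sum_insert hi]
    rw [hmul]
    refine dirac_mul_sub_one_mem _ ?_ ih
    have hcont : Continuous fun r : ℤ_[p] => uni u v ((r : ℚ_[p]) • e i) 0 0 :=
      continuous_uni (continuous_subtype_val.smul continuous_const) continuous_const
        continuous_const
    have := dirac_sub_dirac_mem_span (k := k) hcont (g := uni u v (e i) 0 0)
      (fun r => by simp [uni_mul_uni, add_smul]) (s i)
    simp only [PadicInt.coe_zero, zero_smul, hone, dirac_one] at this
    refine Submodule.span_mono ?_ this
    rw [Set.singleton_subset_iff]
    exact ⟨_, Or.inr (Or.inr ⟨i, rfl⟩), rfl⟩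

/-- As `‖u‖ < 1`, every element of `F` is moved into the lattice spanned by a basis by some power
of `u`. -/
theorem exists_pow_mul_eq_sum [FiniteDimensional ℚ_[p] F] {ι : Type*} [Fintype ι]
    (e : Module.Basis ι ℚ_[p] F) (hu : ‖(u : F)‖ < 1) (a : F) :
    ∃ (n : ℕ) (s : ι → ℤ_[p]), (u : F) ^ n * a = ∑ i, (s i : ℚ_[p]) • e i := by
  have hlim : Filter.Tendsto (fun n : ℕ => e.equivFun ((u : F) ^ n * a)) Filter.atTop (𝓝 0) := by
    have h1 : Filter.Tendsto (fun n : ℕ => (u : F) ^ n * a) Filter.atTop (𝓝 0) := by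
      simpa using (tendsto_pow_atTop_nhds_zero_of_norm_lt_one hu).mul_const a
    have h2 := (LinearMap.continuous_of_finiteDimensional
      (e.equivFun : F →ₗ[ℚ_[p]] ι → ℚ_[p])).tendsto 0
    rw [map_zero] at h2
    exact h2.comp h1
  have hev := hlim.eventually (Metric.ball_mem_nhds 0 one_pos)
  obtain ⟨n, hn⟩ := hev.exists
  have hn' : ∀ i, ‖e.equivFun ((u : F) ^ n * a) i‖ ≤ 1 := fun i =>
    (norm_le_pi_norm _ i).trans (by simpa using (mem_ball_zero_iff.mp hn).le)
  exact ⟨n, fun i => ⟨_, hn' i⟩, (e.sum_equivFun _).symm⟩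

/-- The central element `z` with entry `u * v ^ (M + 1)`, for large `M`, lies outside `P` and is a
commutator in two ways: of root elements with entries `u` and `v ^ (M + 1)`, both of which are
conjugates of generators by positive powers of `t`, and of root elements with entries
`u * v ^ (M + 1)` and `1`, which come from non-positive powers of `t`. -/
theorem exists_integ_charFn_stripe_ne_zero [FiniteDimensional ℚ_[p] F] [IsUltrametricDist F]
    {ι : Type*} [Fintype ι] (e : Module.Basis ι ℚ_[p] F) {ρ : ℝ} (hρ : 1 ≤ ρ)
    (hu : ‖(u : F)‖ < 1) (hv : 1 < ‖(v : F)‖) (L : ℕ) :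
    ∃ c : AugIwasawa k (H3 u v), c * (1 - dirac (t u v)) ∈ augIdeal k (gens u v e) ∧
      c.integ (LocallyConstant.charFn k (isClopen_stripe (zero_lt_one.trans_le hρ) L 0)) ≠ 0 := by
  have hu0 : 0 < ‖(u : F)‖ := norm_pos_iff.mpr u.ne_zero
  have ht := t_zpow_notMem (u := u) (v := v) hu
  obtain ⟨M, hM⟩ := pow_unbounded_of_one_lt (ρ * ‖(v : F)‖ ^ L) hv
  have hM' : ρ * ‖(v : F)‖ ^ L < ‖(v : F)‖ ^ (M + 1) :=
    hM.trans_le (pow_le_pow_right₀ hv.le M.le_succ)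
  let z := uni u v 0 0 (u * v ^ (M + 1))
  have hker : ∀ a b c : F, uni u v a b c ∈ (scale u v).ker := fun a b c => scale_uni a b c
  have hy : (dirac (uni u v 0 1 0) - 1 : AugIwasawa k (H3 u v)) ∈ augIdeal k (gens u v e) :=
    Submodule.subset_span ⟨_, Or.inl rfl, rfl⟩
  have hx : (dirac (uni u v 1 0 0) - 1 : AugIwasawa k (H3 u v)) ∈ augIdeal k (gens u v e) :=
    Submodule.subset_span ⟨_, Or.inr (Or.inl rfl), rfl⟩
  have hz1 : z ∈ fillable (augIdeal k (gens u v e)) (scale u v).ker (t u v) 1 :=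
    uni_zero_zero_mul_mem
      (mem_fillable_one ht 0 (hker _ _ _) hx (by rw [t_pow_mul_uni]; simp))
      (mem_fillable_one ht M (hker _ _ _) hy (by rw [t_pow_mul_uni]; simp))
  have hz0 : z ∈ fillable (augIdeal k (gens u v e)) (scale u v).ker (t u v) 0 := by
    obtain ⟨n, s, hs⟩ := exists_pow_mul_eq_sum e hu ((u : F) * (v : F) ^ (M + 1))
    have hxs := dirac_uni_sub_one_mem (u := u) (v := v) (k := k) (e := e) s
    rw [← hs] at hxs
    have := uni_zero_zero_mul_mem
      (mem_fillable_zero ht n (hker (u * v ^ (M + 1)) 0 0) hxs (by rw [t_pow_mul_uni]; simp))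
      (mem_fillable_zero ht 0 (hker 0 1 0) hy (by simp))
    rwa [mul_one] at this
  obtain ⟨c, hc, hcP⟩ := exists_integ_charFn_eq_one hz0 hz1
  refine ⟨c, hc, ?_⟩
  rw [hcP _ (isClopen_stripe (zero_lt_one.trans_le hρ) L 0)]
  · exact one_ne_zero
  · intro g hg
    exact hg.1.trans (pow_zero _)
  · simp only [stripe, Set.mem_ofPred_eq, map_one, entry]
    simp
    positivity
  · rintro ⟨-, -, -, h⟩
    have : entry z 0 2 = u * v ^ (M + 1) := by simp [z, entry, uni, unitri]
    rw [this, norm_mul, norm_pow, pow_zero, mul_one] at h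
    nlinarith

end Cycle

/-- The ideal `{μ | μ * (1 - t) ∈ I}` is not finitely generated, where `I` is generated by the `h - 1`
for the finitely many root elements `h` in `gens u v e`, with `e` a basis of `F` over `ℚ_p`. -/
theorem exists_finite_not_fg (k : Type*) [Field k] (p : ℕ) [Fact p.Prime] [NormedAlgebra ℚ_[p] F]
    [FiniteDimensional ℚ_[p] F] [IsUltrametricDist F] (hu : ‖(u : F)‖ < 1) (hv : 1 < ‖(v : F)‖) :
    ∃ S : Set (H3 u v), S.Finite ∧
      ∀ J : Submodule (AugIwasawa k (H3 u v)) (AugIwasawa k (H3 u v)),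
        (∀ μ, μ ∈ J ↔ μ * (1 - dirac (t u v)) ∈ augIdeal k S) → ¬ J.FG := by
  let e := Module.finBasis ℚ_[p] F
  refine ⟨gens u v e, ((Set.finite_range _).insert _).insert _, fun J hJ hfg => ?_⟩
  have he : ∀ i, ‖e i‖ ≤ 1 + ∑ j, ‖e j‖ := fun i =>
    (Finset.single_le_sum (fun j _ => norm_nonneg (e j)) (Finset.mem_univ i)).trans
      (le_add_of_nonneg_left zero_le_one)
  have hρ : 1 ≤ 1 + ∑ j, ‖e j‖ :=
    le_add_of_nonneg_right (Finset.sum_nonneg fun j _ => norm_nonneg (e j))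
  obtain ⟨L, hL⟩ := exists_integ_charFn_stripe_eq_zero hρ he hu hv hfg fun μ hμ => (hJ μ).mp hμ
  obtain ⟨c, hc, hc0⟩ := exists_integ_charFn_stripe_ne_zero (k := k) e hρ hu hv L
  exact hc0 (hL c ((hJ c).mpr hc))

end H3

/-! ### Incoherence -/

section Coherence

open AugIwasawa

variable {k G : Type*} [Field k] [Group G] [TopologicalSpace G] [IsTopologicalGroup G]

theorem IsLeftCoherent.exists_fg (h : IsLeftCoherent (AugIwasawa k G))
    {I : Submodule (AugIwasawa k G) (AugIwasawa k G)} (hI : I.FG) (x : AugIwasawa k G) :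
    ∃ J : Submodule (AugIwasawa k G) (AugIwasawa k G), J.FG ∧ ∀ μ, μ ∈ J ↔ μ * x ∈ I :=
  ⟨_, fg_comap_toSpanSingleton h x hI, fun _ => Iff.rfl⟩

/-- The antipode exchanges left and right ideals, so right coherence has the same consequence for left
ideals as left coherence. -/
theorem IsRightCoherent.exists_fg (h : IsRightCoherent (AugIwasawa k G))
    {I : Submodule (AugIwasawa k G) (AugIwasawa k G)} (hI : I.FG) (x : AugIwasawa k G) :
    ∃ J : Submodule (AugIwasawa k G) (AugIwasawa k G), J.FG ∧ ∀ μ, μ ∈ J ↔ μ * x ∈ I := by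
  let σ : AugIwasawa k G →+* (AugIwasawa k G)ᵐᵒᵖ := antipodeEquiv k G
  let τ : (AugIwasawa k G)ᵐᵒᵖ →+* AugIwasawa k G := (antipodeEquiv k G).symm
  have : RingHomSurjective σ := ⟨(antipodeEquiv k G).surjective⟩
  have : RingHomSurjective τ := ⟨(antipodeEquiv k G).symm.surjective⟩
  let A : AugIwasawa k G →ₛₗ[σ] AugIwasawa k G :=
    { toFun := antipode
      map_add' := fun _ _ => rfl
      map_smul' := antipode_mul }
  let B : (AugIwasawa k G)ᵐᵒᵖ →ₛₗ[τ] AugIwasawa k G :=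
    { toFun := τ
      map_add' := map_add τ
      map_smul' := map_mul τ }
  refine ⟨_, (fg_comap_toSpanSingleton h (antipode x) (hI.map A)).map B, fun μ => ?_⟩
  have hA : ∀ r, antipode r ∈ I.map A ↔ r ∈ I := fun r => by
    constructor
    · rintro ⟨s, hs, hsr⟩
      have : s = r := by
        rw [← antipode_antipode s, ← antipode_antipode r]
        exact congrArg antipode hsr
      exact this ▸ hs
    · exact fun hr => ⟨r, hr, rfl⟩
  rw [← hA, antipode_mul]
  constructor
  · rintro ⟨s, hs, rfl⟩
    change antipode x * antipode (antipode s.unop) ∈ _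
    rw [antipode_antipode]
    exact hs
  · intro hμ
    exact ⟨MulOpposite.op (antipode μ), hμ, antipode_antipode μ⟩

end Coherence

theorem mainTheorem2 (p : ℕ) [Fact p.Prime]
    (F : Type*) [NormedField F] [NormedAlgebra ℚ_[p] F] [FiniteDimensional ℚ_[p] F]
    (k : Type*) [Field k] [CharP k p]
    (u v : Fˣ) (hu : 0 < valF p u) (hv : valF p v < 0) :
    ¬ IsLeftCoherent (AugIwasawa k (H3 u v)) ∧ ¬ IsRightCoherent (AugIwasawa k (H3 u v)) := by
  have : IsUltrametricDist F :=
    IsUltrametricDist.isUltrametricDist_of_forall_norm_natCast_le_one fun n => by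
      rw [← map_natCast (algebraMap ℚ_[p] F) n, norm_algebraMap']
      exact Padic.norm_int_le_one (n : ℤ)
  obtain ⟨ϖ, hϖ⟩ := exists_isUniformizer p F
  have hϖ0 : 0 < ‖ϖ‖ := norm_pos_iff.mpr hϖ.1
  have hu1 : ‖(u : F)‖ < 1 := by
    rw [hϖ.norm_eq_zpow_valF p u]
    exact zpow_lt_one₀ hϖ0 hϖ.2.1 hu
  have hv1 : 1 < ‖(v : F)‖ := by
    rw [hϖ.norm_eq_zpow_valF p v]
    exact one_lt_zpow_of_neg₀ hϖ0 hϖ.2.1 hv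
  obtain ⟨S, hS, hJ⟩ := H3.exists_finite_not_fg k p hu1 hv1
  refine ⟨fun h => ?_, fun h => ?_⟩
  · obtain ⟨J, hfg, hmem⟩ :=
      h.exists_fg (AugIwasawa.fg_augIdeal hS) (1 - AugIwasawa.dirac (H3.t u v))
    exact hJ J hmem hfg
  · obtain ⟨J, hfg, hmem⟩ :=
      h.exists_fg (AugIwasawa.fg_augIdeal hS) (1 - AugIwasawa.dirac (H3.t u v))
    exact hJ J hmem hfg
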